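/- Let $\mathbb G$ be a compact (Hausdorff) group, $d\ge 1$, and $\pi:\mathbb G\to U(d)$ a continuous, non-trivial, irreducible unitary representation. Let $p_n,q_n\in[0,1]$ and $\sigma_n\ge 0$ be sequences, and for every $n$ let $E,\Delta,\Pi,\mathcal E$ be independent random Hermitian $nd\times nd$ matrices with $d\times d$ blocks, whose blocks above the diagonal are independent and distributed as follows, and whose blocks below the diagonal are determined by Hermitian symmetry. Each block of $E$ is all-ones with probability $q_n$ and zero otherwise; each block of $\Delta$ is all-ones with probability $p_n$ and zero otherwise; each block of $\Pi$ is $\pi(g)$ with $g$ distributed by the normalized Haar measure of $\mathbb G$; each block of $\mathcal E$ has i.i.d. standard Gaussian entries (all real, or all complex, with mean $0$ and absolute second moment $1$). The diagonal blocks of $E$ and $\Delta$ are all-ones, those of $\Pi$ and $\mathcal E$ are zero. Put $\tau_n=\sqrt{q_n(1-p_n+\sigma_n^2)}$, $$\mathcal W_n=\frac{1}{\tau_n\sqrt n}\,E\odot\Big((\mathbf 1\mathbf 1^*-\Delta)\odot\Pi+\frac{\sigma_n}{\sqrt d}\,\mathcal E\Big),\qquad \beta_n=\frac{\sqrt n\,\tau_n}{n\,p_nq_n},$$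 where $\odot$ is the entrywise product, and $\beta_n\mathcal W_n$ is read as $0$ when $\tau_n=0$. (For the finitely many $n$ with $p_nq_n=0$ the value of $\beta_n$ is irrelevant.) There is a universal constant $c_0>1$ (independent of $\mathbb G$, $d$, $\pi$ and of the sequences) such that every $c\ge c_0$ has the following property: if $n p_nq_n=\omega(\log^c n)$ and $\sqrt{n p_nq_n}\,\beta_n=o(1)$ as $n\to\infty$, then $\|\beta_n\mathcal W_n\|\to 0$ almost surely, where $\|\cdot\|$ is the operator norm. This holds whatever the joint distribution of the models for different $n$ on a common probability space. -/

import Mathlib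

open MeasureTheory ProbabilityTheory Filter Topology Asymptotics
open scoped Matrix

noncomputable section

namespace GroupSync

/-- The pairs `i < j` of vertices of `[n]`: the block positions strictly above the diagonal. -/
abbrev Edge (n : ℕ) : Type := {e : Fin n × Fin n // e.1 < e.2}

/-- An `nd × nd` complex matrix, as an `n × n` array of `d × d` blocks. -/
abbrev BlockMatrix (d n : ℕ) : Type := Matrix (Fin n × Fin d) (Fin n × Fin d) ℂ

/-- The operator (spectral) norm of a block matrix with respect to the Euclidean norm. -/
def opNorm {d n : ℕ} (M : BlockMatrix d n) : ℝ :=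
  ‖Matrix.toEuclideanCLM (n := Fin n × Fin d) (𝕜 := ℂ) M‖

/-- The Hermitian extension: the blocks above the diagonal are `B`, the blocks below the diagonal
are their conjugate transposes, and every block on the diagonal is `D`. -/
def hermitianBlock {d n : ℕ} (D : Matrix (Fin d) (Fin d) ℂ)
    (B : Edge n → Matrix (Fin d) (Fin d) ℂ) : BlockMatrix d n :=
  Matrix.of fun x y =>
    if h : x.1 < y.1 then B ⟨(x.1, y.1), h⟩ x.2 y.2
    else if h : y.1 < x.1 then (B ⟨(y.1, x.1), h⟩)ᴴ x.2 y.2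
    else D x.2 y.2

/-- The matrix all of whose entries are one. -/
def allOnes (ι : Type*) : Matrix ι ι ℂ := Matrix.of fun _ _ => 1

/-- The `d`-dimensional representation of `G` on `ℂ^d` given by a homomorphism into `U(d)`. -/
def toRepresentation {G : Type*} [Group G] {d : ℕ} (π : G →* Matrix.unitaryGroup (Fin d) ℂ) :
    Representation ℂ G (Fin d → ℂ) :=
  (((Matrix.toLinAlgEquiv' : Matrix (Fin d) (Fin d) ℂ ≃ₐ[ℂ] _) :
      Matrix (Fin d) (Fin d) ℂ →* ((Fin d → ℂ) →ₗ[ℂ] (Fin d → ℂ))).comp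
    (Matrix.unitaryGroup (Fin d) ℂ).subtype).comp π

/-- The entries of the additive noise are either real or complex Gaussian. -/
inductive GaussianKind : Type
  | real : GaussianKind
  | complex : GaussianKind

/-- The law on `ℂ` of a standard Gaussian entry: `N(0,1)` in the real case, and `X + iY` with
`X, Y` independent `N(0,1/2)` in the complex case. -/
def gaussianEntry : GaussianKind → Measure ℂ
  | .real => (gaussianReal 0 1).map (fun x : ℝ => (x : ℂ))
  | .complex => ((gaussianReal 0 (1 / 2)).prod (gaussianReal 0 (1 / 2))).map
      (fun z : ℝ × ℝ => (z.1 : ℂ) + (z.2 : ℂ) * Complex.I)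

instance (k : GaussianKind) : IsProbabilityMeasure (gaussianEntry k) := by
  cases k
  · exact Measure.isProbabilityMeasure_map (by fun_prop)
  · exact Measure.isProbabilityMeasure_map (by fun_prop)

/-- The normalized Haar measure of a compact group. -/
def normalizedHaar (G : Type*) [Group G] [TopologicalSpace G] [IsTopologicalGroup G]
    [CompactSpace G] [MeasurableSpace G] [BorelSpace G] : Measure G :=
  Measure.haarMeasure ⊤

instance (G : Type*) [Group G] [TopologicalSpace G] [IsTopologicalGroup G]
    [CompactSpace G] [MeasurableSpace G] [BorelSpace G] :
    IsProbabilityMeasure (normalizedHaar G) :=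
  ⟨by simpa [normalizedHaar] using Measure.haarMeasure_self (G := G) (K₀ := ⊤)⟩

/-- The randomness attached to one pair `i < j`: whether the pair is observed (the block of `E`
is all-ones), whether it is not an outlier (the block of `Δ` is all-ones), the random group
element of the pair, and its additive noise block. -/
abbrev EdgeSample (G : Type*) (d : ℕ) : Type _ :=
  Bool × Bool × G × (Fin d → Fin d → ℂ)

/-- All the randomness of the `nd × nd` model. -/
abbrev Sample (G : Type*) (d n : ℕ) : Type _ := Edge n → EdgeSample G d

section Law

variable (G : Type*) [Group G] [TopologicalSpace G] [IsTopologicalGroup G]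
  [CompactSpace G] [MeasurableSpace G] [BorelSpace G]

/-- The law attached to one pair: independently, an observation bit with success probability `q`,
a correctness bit with success probability `p`, a Haar distributed group element, and a `d × d`
matrix of i.i.d. standard Gaussian entries. -/
def edgeLaw (d : ℕ) (k : GaussianKind) (p q : unitInterval) : Measure (EdgeSample G d) :=
  (bernoulliMeasure true false q).prod
    ((bernoulliMeasure true false p).prod
      ((normalizedHaar G).prod
        (Measure.pi fun _ : Fin d => Measure.pi fun _ : Fin d => gaussianEntry k)))

instance (d : ℕ) (k : GaussianKind) (p q : unitInterval) :
    IsProbabilityMeasure (edgeLaw G d k p q) := by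
  unfold edgeLaw; infer_instance

/-- The law of the `nd × nd` model: the pairs `i < j` are independent. -/
def sampleLaw (d n : ℕ) (k : GaussianKind) (p q : unitInterval) : Measure (Sample G d n) :=
  Measure.pi fun _ : Edge n => edgeLaw G d k p q

instance (d n : ℕ) (k : GaussianKind) (p q : unitInterval) :
    IsProbabilityMeasure (sampleLaw G d n k p q) := by
  unfold sampleLaw; infer_instance

end Law

section Matrices

variable {G : Type*} [Group G] {d n : ℕ}

/-- The block matrix `E` of observed pairs; its diagonal blocks are all-ones. -/
def observed (s : Sample G d n) : BlockMatrix d n :=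
  hermitianBlock (allOnes (Fin d)) fun e => if (s e).1 then allOnes (Fin d) else 0

/-- The block matrix `Δ` of pairs that are not outliers; its diagonal blocks are all-ones. -/
def correct (s : Sample G d n) : BlockMatrix d n :=
  hermitianBlock (allOnes (Fin d)) fun e => if (s e).2.1 then allOnes (Fin d) else 0

/-- The block matrix `Π` of random group elements; its diagonal blocks are zero. -/
def outlier (π : G →* Matrix.unitaryGroup (Fin d) ℂ) (s : Sample G d n) : BlockMatrix d n :=
  hermitianBlock 0 fun e => (π (s e).2.2.1 : Matrix (Fin d) (Fin d) ℂ)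

/-- The block matrix `ℰ` of Gaussian noise; its diagonal blocks are zero. -/
def additive (s : Sample G d n) : BlockMatrix d n :=
  hermitianBlock 0 fun e => Matrix.of (s e).2.2.2

/-- `τ = √(q (1 - p + σ²))`. -/
def tau (p q σ : ℝ) : ℝ := √(q * (1 - p + σ ^ 2))

/-- The noise-to-signal ratio `β = √n τ / (n q p)`. -/
def beta (n : ℕ) (p q σ : ℝ) : ℝ := √n * tau p q σ / (n * q * p)

/-- The noise matrix `𝒲 = (1 / (τ √n)) E ⊙ ((𝟙𝟙* - Δ) ⊙ Π + (σ / √d) ℰ)`. -/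
def noiseMatrix (π : G →* Matrix.unitaryGroup (Fin d) ℂ) (p q σ : ℝ) (s : Sample G d n) :
    BlockMatrix d n :=
  ((1 / (tau p q σ * √n) : ℝ) : ℂ) •
    (observed s ⊙
      ((allOnes (Fin n × Fin d) - correct s) ⊙ outlier π s + ((σ / √d : ℝ) : ℂ) • additive s))

end Matrices

end GroupSync

end

/-!
The two asymptotic hypotheses together are strong. Squaring the second one gives
`(1 - p + σ²) / p → 0`, so `p → 1` and `σ → 0`: almost no observed pair is an outlier, and the
Gaussian part is small. Moreover `n p q` grows faster than `log n`. Under these conditions the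
operator norm can be controlled by absolute row sums, without any cancellation in the noise.

Up to the factor `1 / (n p q)`, the matrix `β 𝒲` is `rawNoise`. The entries of its block at a pair
are bounded by `edgeWeight`, which is zero for an unobserved pair and otherwise the outlier
indicator plus `σ` times the sum of the moduli of the Gaussian entries. By Schur's test
(`norm_toEuclideanCLM_le_of_sum_le`), `‖β 𝒲‖` is at most `d / (n p q)` times the largest
`rowWeight`, a sum of at most `n` independent edge weights.

The exponential moment of an edge weight is at most `1 + q (4 (1 - p) + K σ)` with a constant `K`
depending only on `d` and the kind of Gaussian (`exp_edgeWeight_le`,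
`integrable_and_integral_expBound`). Since `4 (1 - p) + K σ → 0`, Chernoff's inequality bounds
the probability that a given row weight exceeds `ε n p q` by `exp (-ε n p q / 2)`, eventually at
most `n⁻³`. A union bound over the `n` rows and the Borel–Cantelli lemma finish the proof; the
latter needs no assumption on the joint law for different `n`.
-/

namespace GroupSync

/-! ### Schur's test -/

/-- **Schur's test**: the spectral norm is at most any common bound for the absolute row and
column sums. -/
theorem norm_toEuclideanCLM_le_of_sum_le {ι : Type*} [Fintype ι] [DecidableEq ι]
    (M : Matrix ι ι ℂ) {R : ℝ} (hR : 0 ≤ R) (hrow : ∀ x, ∑ y, ‖M x y‖ ≤ R)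
    (hcol : ∀ y, ∑ x, ‖M x y‖ ≤ R) :
    ‖Matrix.toEuclideanCLM (n := ι) (𝕜 := ℂ) M‖ ≤ R := by
  refine ContinuousLinearMap.opNorm_le_bound _ hR fun v => ?_
  refine abs_le_of_sq_le_sq' ?_ (by positivity) |>.2
  rw [mul_pow, EuclideanSpace.norm_sq_eq, EuclideanSpace.norm_sq_eq]
  -- Cauchy–Schwarz for the weights `‖M x y‖` in each row
  have hx : ∀ x, ‖(Matrix.toEuclideanCLM (n := ι) (𝕜 := ℂ) M v) x‖ ^ 2 ≤
      R * ∑ y, ‖M x y‖ * ‖v y‖ ^ 2 := by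
    intro x
    calc ‖(Matrix.toEuclideanCLM (n := ι) (𝕜 := ℂ) M v) x‖ ^ 2
        ≤ (∑ y, ‖M x y‖ * ‖v y‖) ^ 2 := by
          gcongr
          rw [Matrix.ofLp_toEuclideanCLM]
          refine (norm_sum_le _ _).trans (le_of_eq ?_)
          simp
      _ ≤ (∑ y, ‖M x y‖) * ∑ y, ‖M x y‖ * ‖v y‖ ^ 2 :=
          Finset.sum_sq_le_sum_mul_sum_of_sq_le_mul _ (fun _ _ => by positivity)
            (fun _ _ => by positivity) (fun y _ => le_of_eq (by ring))
      _ ≤ R * ∑ y, ‖M x y‖ * ‖v y‖ ^ 2 := by gcongr; exact hrow x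
  calc ∑ x, ‖(Matrix.toEuclideanCLM (n := ι) (𝕜 := ℂ) M v) x‖ ^ 2
      ≤ ∑ x, R * ∑ y, ‖M x y‖ * ‖v y‖ ^ 2 := Finset.sum_le_sum fun x _ => hx x
    _ = R * ∑ y, (∑ x, ‖M x y‖) * ‖v y‖ ^ 2 := by
        rw [← Finset.mul_sum, Finset.sum_comm]
        simp_rw [Finset.sum_mul]
    _ ≤ R * ∑ y, R * ‖v y‖ ^ 2 := by gcongr with y; exact hcol y
    _ = R ^ 2 * ∑ y, ‖v y‖ ^ 2 := by rw [← Finset.mul_sum]; ring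

/-! ### Domination of the noise matrix by edge weights -/

section Weights

variable {G : Type*} {d n : ℕ}

/-- The pair formed by two distinct vertices, in increasing order. -/
def edgeBetween (i j : Fin n) (h : j ≠ i) : Edge n :=
  if hij : i < j then ⟨(i, j), hij⟩ else ⟨(j, i), lt_of_le_of_ne (not_lt.1 hij) h⟩

theorem edgeBetween_comm (i j : Fin n) (h : j ≠ i) :
    edgeBetween j i h.symm = edgeBetween i j h := by
  unfold edgeBetween
  split_ifs with h1 h2 h2
  · exact absurd h1 h2.asymm
  · rfl
  · rfl
  · exact absurd (le_antisymm (not_lt.1 h1) (not_lt.1 h2)) h.symm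

theorem edgeBetween_injective (i : Fin n) :
    Function.Injective fun j : {j // j ≠ i} => edgeBetween i j.1 j.2 := by
  rintro ⟨j, hj⟩ ⟨k, hk⟩ h
  simp only [edgeBetween] at h
  split_ifs at h <;> simp_all

/-- A bound for the entries of the noise block at one pair: zero if the pair is not observed, and
otherwise the outlier indicator plus `σ` times the sum of the moduli of the additive noise. It does
not involve the group element, so it is measurable on any compact group. -/
noncomputable def edgeWeight (σ : ℝ) (x : EdgeSample G d) : ℝ :=
  if x.1 then (if x.2.1 then 0 else 1) + σ * ∑ a, ∑ b, ‖x.2.2.2 a b‖ else 0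

/-- The total weight of the pairs that contain the vertex `i`. -/
noncomputable def rowWeight (σ : ℝ) (s : Sample G d n) (i : Fin n) : ℝ :=
  ∑ j : {j // j ≠ i}, edgeWeight σ (s (edgeBetween i j.1 j.2))

variable [Group G]

/-- The noise matrix without its normalizing factor `1 / (τ √n)`. -/
noncomputable def rawNoise (π : G →* Matrix.unitaryGroup (Fin d) ℂ) (σ : ℝ) (s : Sample G d n) :
    BlockMatrix d n :=
  observed s ⊙
    ((allOnes (Fin n × Fin d) - correct s) ⊙ outlier π s + ((σ / √d : ℝ) : ℂ) • additive s)

/-- The entries of a noise block are bounded by the weight of its pair, as entries of a unitary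
matrix have modulus at most one. -/
theorem norm_block_entry_le (π : G →* Matrix.unitaryGroup (Fin d) ℂ) {σ : ℝ} (hσ : 0 ≤ σ)
    (x : EdgeSample G d) (a b : Fin d) :
    ‖(if x.1 then (1 : ℂ) else 0) *
        ((1 - if x.2.1 then (1 : ℂ) else 0) * (π x.2.2.1 : Matrix (Fin d) (Fin d) ℂ) a b +
          ((σ / √d : ℝ) : ℂ) * x.2.2.2 a b)‖ ≤ edgeWeight σ x := by
  have hd : σ / √d ≤ σ := div_le_self hσ <| by
    rw [Real.one_le_sqrt]
    exact_mod_cast Nat.one_le_iff_ne_zero.2 (Nat.ne_of_gt (Fin.pos a))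
  have hG : ‖x.2.2.2 a b‖ ≤ ∑ a, ∑ b, ‖x.2.2.2 a b‖ :=
    (Finset.single_le_sum (f := fun b => ‖x.2.2.2 a b‖) (fun _ _ => norm_nonneg _)
      (Finset.mem_univ b)).trans
    (Finset.single_le_sum (f := fun a => ∑ b, ‖x.2.2.2 a b‖)
      (fun _ _ => Finset.sum_nonneg fun _ _ => norm_nonneg _) (Finset.mem_univ a))
  have hπ : ‖(π x.2.2.1 : Matrix (Fin d) (Fin d) ℂ) a b‖ ≤ 1 :=
    entry_norm_bound_of_unitary (π x.2.2.1).2 a b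
  have hN : ‖((σ / √d : ℝ) : ℂ) * x.2.2.2 a b‖ ≤ σ * ∑ a, ∑ b, ‖x.2.2.2 a b‖ := by
    rw [norm_mul, Complex.norm_real, Real.norm_of_nonneg (by positivity)]
    gcongr
  unfold edgeWeight
  split_ifs
  · simpa using hN
  · simpa using (norm_add_le _ _).trans (add_le_add hπ hN)
  all_goals simp

theorem rawNoise_apply_of_lt (π : G →* Matrix.unitaryGroup (Fin d) ℂ) (σ : ℝ)
    (s : Sample G d n) (x y : Fin n × Fin d) (h : x.1 < y.1) :
    rawNoise π σ s x y = (if (s ⟨(x.1, y.1), h⟩).1 then (1 : ℂ) else 0) *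
        ((1 - if (s ⟨(x.1, y.1), h⟩).2.1 then (1 : ℂ) else 0) *
          (π (s ⟨(x.1, y.1), h⟩).2.2.1 : Matrix (Fin d) (Fin d) ℂ) x.2 y.2 +
          ((σ / √d : ℝ) : ℂ) * (s ⟨(x.1, y.1), h⟩).2.2.2 x.2 y.2) := by
  simp [rawNoise, observed, correct, outlier, additive, hermitianBlock, allOnes, h]
  split_ifs <;> simp

theorem rawNoise_apply_of_gt (π : G →* Matrix.unitaryGroup (Fin d) ℂ) (σ : ℝ)
    (s : Sample G d n) (x y : Fin n × Fin d) (h : y.1 < x.1) :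
    rawNoise π σ s x y = star (rawNoise π σ s y x) := by
  rw [rawNoise_apply_of_lt π σ s y x h]
  simp [rawNoise, observed, correct, outlier, additive, hermitianBlock, allOnes, h, h.asymm]
  split_ifs <;> simp

theorem rawNoise_apply_of_eq (π : G →* Matrix.unitaryGroup (Fin d) ℂ) (σ : ℝ)
    (s : Sample G d n) (x y : Fin n × Fin d) (h : y.1 = x.1) : rawNoise π σ s x y = 0 := by
  simp [rawNoise, observed, correct, outlier, additive, hermitianBlock, allOnes, h]

theorem norm_rawNoise_apply_le (π : G →* Matrix.unitaryGroup (Fin d) ℂ) {σ : ℝ} (hσ : 0 ≤ σ)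
    (s : Sample G d n) (x y : Fin n × Fin d) :
    ‖rawNoise π σ s x y‖ ≤
      if h : y.1 ≠ x.1 then edgeWeight σ (s (edgeBetween x.1 y.1 h)) else 0 := by
  rcases lt_trichotomy x.1 y.1 with h | h | h
  · rw [dif_pos h.ne', edgeBetween, dif_pos h, rawNoise_apply_of_lt π σ s x y h]
    exact norm_block_entry_le π hσ _ _ _
  · rw [rawNoise_apply_of_eq π σ s x y h.symm, dif_neg (not_not.2 h.symm), norm_zero]
  · rw [dif_pos h.ne, edgeBetween, dif_neg h.asymm, rawNoise_apply_of_gt π σ s x y h, norm_star,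
      rawNoise_apply_of_lt π σ s y x h]
    exact norm_block_entry_le π hσ _ _ _

theorem opNorm_rawNoise_le (π : G →* Matrix.unitaryGroup (Fin d) ℂ) {σ R : ℝ} (hσ : 0 ≤ σ)
    (hR : 0 ≤ R) (s : Sample G d n) (h : ∀ i, rowWeight σ s i ≤ R) :
    opNorm (rawNoise π σ s) ≤ d * R := by
  have key : ∀ x : Fin n × Fin d,
      ∑ y : Fin n × Fin d, (if h : y.1 ≠ x.1 then edgeWeight σ (s (edgeBetween x.1 y.1 h)) else 0)
        ≤ d * R := by
    intro x
    have hsum : ∀ f : Fin n → ℝ, ∑ y : Fin n × Fin d, f y.1 = d * ∑ j, f j := fun f => by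
      simp [Fintype.sum_prod_type, Finset.mul_sum]
    rw [hsum fun j => if h : j ≠ x.1 then edgeWeight σ (s (edgeBetween x.1 j h)) else 0]
    refine mul_le_mul_of_nonneg_left (le_trans (le_of_eq ?_) (h x.1)) (Nat.cast_nonneg d)
    rw [rowWeight, Finset.sum_dite, Finset.sum_const_zero, add_zero]
    refine Finset.sum_bij (fun j _ => ⟨j.1, (Finset.mem_filter.1 j.2).2⟩) ?_ ?_ ?_ ?_
    · simp
    · rintro ⟨a, _⟩ _ ⟨b, _⟩ _ hab
      simpa using hab
    · rintro ⟨b, hb⟩ _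
      exact ⟨⟨b, by simpa using hb⟩, by simp, rfl⟩
    · simp
  refine norm_toEuclideanCLM_le_of_sum_le _ (by positivity) (fun x => ?_) (fun y => ?_)
  · exact (Finset.sum_le_sum fun y _ => norm_rawNoise_apply_le π hσ s x y).trans (key x)
  · refine (Finset.sum_le_sum fun x _ => norm_rawNoise_apply_le π hσ s x y).trans
      (le_trans (le_of_eq ?_) (key y))
    refine Finset.sum_congr rfl fun x _ => ?_
    by_cases hxy : x.1 = y.1
    · simp [hxy]
    · rw [dif_pos (Ne.symm hxy), dif_pos hxy, edgeBetween_comm]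

/-- Since `β / (τ √n) = 1 / (n p q)`, the rescaled noise is controlled by the row weights. The bound
also holds when `τ = 0`, where `β = 0`. -/
theorem opNorm_beta_smul_noiseMatrix_le (π : G →* Matrix.unitaryGroup (Fin d) ℂ)
    {p q σ R : ℝ} (hp : 0 ≤ p) (hq : 0 ≤ q) (hσ : 0 ≤ σ)
    (hR : 0 ≤ R) (s : Sample G d n) (h : ∀ i, rowWeight σ s i ≤ R) :
    opNorm ((beta n p q σ : ℂ) • noiseMatrix π p q σ s) ≤ (n * p * q)⁻¹ * (d * R) := by
  have hscal : ‖(beta n p q σ : ℂ) * ((1 / (tau p q σ * √n) : ℝ) : ℂ)‖ ≤ (n * p * q : ℝ)⁻¹ := by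
    rw [← Complex.ofReal_mul, Complex.norm_real]
    by_cases h0 : √n * tau p q σ = 0
    · rw [beta, h0]; simp; positivity
    · have : beta n p q σ * (1 / (tau p q σ * √n)) = (n * p * q)⁻¹ := by
        rw [beta, mul_comm (tau p q σ), div_mul_div_comm, mul_one, mul_comm _ (√n * _),
          ← div_div, div_self h0, one_div, mul_right_comm]
      rw [this, Real.norm_of_nonneg (by positivity)]
  have hM : (beta n p q σ : ℂ) • noiseMatrix π p q σ s =
      ((beta n p q σ : ℂ) * ((1 / (tau p q σ * √n) : ℝ) : ℂ)) • rawNoise π σ s := by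
    rw [noiseMatrix, smul_smul]; rfl
  rw [hM, opNorm, map_smul, norm_smul]
  exact mul_le_mul hscal (opNorm_rawNoise_le π hσ hR s h) (norm_nonneg _) (by positivity)

end Weights

/-! ### Exponential moments of the Gaussian blocks -/

theorem integrable_exp_mul_abs_gaussianReal (t : ℝ) (v : NNReal) :
    Integrable (fun x : ℝ => Real.exp (t * |x|)) (gaussianReal 0 v) := by
  refine ((integrable_exp_mul_gaussianReal (μ := 0) (v := v) t).add
    (integrable_exp_mul_gaussianReal (μ := 0) (v := v) (-t))).mono' (by fun_prop) ?_
  refine ae_of_all _ fun x => ?_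
  rw [Real.norm_of_nonneg (Real.exp_pos _).le, Pi.add_apply]
  rcases abs_cases x with ⟨h, _⟩ | ⟨h, _⟩ <;> rw [h]
  · linarith [Real.exp_pos (-t * x)]
  · rw [mul_neg, ← neg_mul]; linarith [Real.exp_pos (t * x)]

theorem integrable_exp_mul_norm_gaussianEntry (k : GaussianKind) {t : ℝ} (ht : 0 ≤ t) :
    Integrable (fun z : ℂ => Real.exp (t * ‖z‖)) (gaussianEntry k) := by
  cases k
  · rw [gaussianEntry, integrable_map_measure (by fun_prop) (by fun_prop)]
    simpa [Function.comp_def] using integrable_exp_mul_abs_gaussianReal t 1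
  · rw [gaussianEntry, integrable_map_measure (by fun_prop) (by fun_prop)]
    refine ((integrable_exp_mul_abs_gaussianReal t (1 / 2)).mul_prod
      (integrable_exp_mul_abs_gaussianReal t (1 / 2))).mono' (by fun_prop) ?_
    refine ae_of_all _ fun z => ?_
    rw [Function.comp_apply, Real.norm_of_nonneg (Real.exp_pos _).le, ← Real.exp_add, ← mul_add]
    refine Real.exp_le_exp.2 (mul_le_mul_of_nonneg_left ((norm_add_le _ _).trans ?_) ht)
    simp

/-- The law of a `d × d` block of independent standard Gaussian entries. -/
noncomputable abbrev gaussianBlock (d : ℕ) (k : GaussianKind) : Measure (Fin d → Fin d → ℂ) :=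
  Measure.pi fun _ : Fin d => Measure.pi fun _ : Fin d => gaussianEntry k

theorem integrable_exp_sum_norm_gaussianBlock (d : ℕ) (k : GaussianKind) {t : ℝ} (ht : 0 ≤ t) :
    Integrable (fun g : Fin d → Fin d → ℂ => Real.exp (t * ∑ a, ∑ b, ‖g a b‖))
      (gaussianBlock d k) := by
  simp_rw [Finset.mul_sum, Real.exp_sum]
  exact Integrable.fintype_prod fun _ => Integrable.fintype_prod fun _ =>
    integrable_exp_mul_norm_gaussianEntry k ht

/-- The exponential moment, at parameter `2`, of the sum of the moduli of the entries of a Gaussian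
block. -/
noncomputable def blockMoment (d : ℕ) (k : GaussianKind) : ℝ :=
  ∫ g, Real.exp (2 * ∑ a, ∑ b, ‖g a b‖) ∂gaussianBlock d k

/-! ### Tail bound for the row weights -/

section Tail

variable {G : Type*} {d n : ℕ}

theorem measurable_edgeWeight [MeasurableSpace G] (σ : ℝ) :
    Measurable (edgeWeight σ : EdgeSample G d → ℝ) := by
  unfold edgeWeight
  refine Measurable.ite ?_ (Measurable.add (Measurable.ite ?_ ?_ ?_) ?_) measurable_const
  · exact measurable_fst (measurableSet_singleton true)
  · exact measurable_snd.fst (measurableSet_singleton true)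
  · fun_prop
  · fun_prop
  · fun_prop

theorem measurable_rowWeight [MeasurableSpace G] (σ : ℝ) (i : Fin n) :
    Measurable fun s : Sample G d n => rowWeight σ s i :=
  Finset.measurable_fun_sum _ fun _ _ => (measurable_edgeWeight σ).comp (measurable_pi_apply _)

/-- An upper bound for `exp (edgeWeight σ x)` when `σ ≤ 1`. It is a sum of products of functions
of the four independent components of `x`; the factors `1` stand for the components that do not
occur, so that its integral factorizes. -/
noncomputable def expBound (σ : ℝ) (x : EdgeSample G d) : ℝ :=
  1 + ((if x.1 then 1 else 0) * ((if x.2.1 then 0 else 4) * 1) +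
    (if x.1 then 1 else 0) * (1 * (1 * (σ * Real.exp (2 * ∑ a, ∑ b, ‖x.2.2.2 a b‖)))))

/-- The outlier part and the Gaussian part are separated by the inequality between the arithmetic
and the geometric mean, and `σ` is taken out of the exponent by convexity. -/
theorem exp_edgeWeight_le {σ : ℝ} (h0 : 0 ≤ σ) (h1 : σ ≤ 1) (x : EdgeSample G d) :
    Real.exp (edgeWeight σ x) ≤ expBound σ x := by
  have hconv : ∀ h : ℝ, Real.exp (σ * h) ≤ 1 - σ + σ * Real.exp h := fun h => by
    have := convexOn_exp.2 (Set.mem_univ 0) (Set.mem_univ h) (sub_nonneg.2 h1) h0 (by ring)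
    simpa using this
  set H := ∑ a, ∑ b, ‖x.2.2.2 a b‖ with hH
  have h2 : Real.exp (2 * (σ * H)) ≤ 1 - σ + σ * Real.exp (2 * H) := by
    rw [mul_left_comm]; exact hconv _
  have hamgm : ∀ u v : ℝ, Real.exp (u + v) ≤ (Real.exp (2 * u) + Real.exp (2 * v)) / 2 :=
    fun u v => by
      rw [Real.exp_add, two_mul, two_mul, Real.exp_add, Real.exp_add]
      nlinarith [sq_nonneg (Real.exp u - Real.exp v)]
  have hexp2 : Real.exp 2 ≤ 9 := by
    have := Real.exp_one_lt_d9
    have h3 : Real.exp 2 = Real.exp 1 ^ 2 := by rw [← Real.exp_nat_mul]; norm_num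
    rw [h3]; nlinarith [Real.exp_pos 1]
  have hpos := mul_nonneg h0 (Real.exp_pos (2 * H)).le
  unfold edgeWeight expBound
  rw [← hH]
  split_ifs
  · have := hamgm 0 (σ * H)
    simp only [mul_zero, Real.exp_zero] at this
    linarith
  · have := hamgm 1 (σ * H)
    rw [mul_one] at this
    linarith
  all_goals simp

variable [Group G] [TopologicalSpace G] [IsTopologicalGroup G]
  [CompactSpace G] [MeasurableSpace G] [BorelSpace G]

theorem integrable_and_integral_expBound (k : GaussianKind) (p q : unitInterval) (σ : ℝ) :
    Integrable (expBound σ) (edgeLaw G d k p q) ∧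
      ∫ x, expBound σ x ∂edgeLaw G d k p q =
        1 + q * (4 * (1 - p) + σ * blockMoment d k) := by
  have hb : ∀ (r : unitInterval) (u v : ℝ),
      ∫ b, (if b = true then u else v) ∂bernoulliMeasure true false r = r * u + (1 - r) * v := by
    intro r u v
    rw [integral_bernoulliMeasure]
    simp
  have hint : ∀ (r : unitInterval) (u v : ℝ),
      Integrable (fun b => if b = true then u else v) (bernoulliMeasure true false r) :=
    fun r u v => integrable_bernoulliMeasure _ _ _ _
  have hg := (integrable_exp_sum_norm_gaussianBlock d k zero_le_two).const_mul σ
  have hA : Integrable (fun x : EdgeSample G d => (if x.1 then (1 : ℝ) else 0) *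
      ((if x.2.1 then 0 else 4) * 1)) (edgeLaw G d k p q) :=
    (hint q 1 0).mul_prod ((hint p 0 4).mul_prod (integrable_const 1))
  have hB : Integrable (fun x : EdgeSample G d => (if x.1 then (1 : ℝ) else 0) *
      (1 * (1 * (σ * Real.exp (2 * ∑ a, ∑ b, ‖x.2.2.2 a b‖))))) (edgeLaw G d k p q) :=
    (hint q 1 0).mul_prod ((integrable_const 1).mul_prod ((integrable_const 1).mul_prod hg))
  refine ⟨(integrable_const 1).add (hA.add hB), ?_⟩
  have eA : ∫ x : EdgeSample G d, (if x.1 then (1 : ℝ) else 0) *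
      ((if x.2.1 then 0 else 4) * 1) ∂edgeLaw G d k p q = q * (4 * (1 - p)) := by
    rw [edgeLaw, integral_prod_mul (fun b : Bool => if b then (1 : ℝ) else 0)
      (fun y : Bool × G × (Fin d → Fin d → ℂ) => (if y.1 then (0 : ℝ) else 4) * 1),
      integral_prod_mul (fun b : Bool => if b then (0 : ℝ) else 4)
      (fun _ : G × (Fin d → Fin d → ℂ) => (1 : ℝ)), hb, hb]
    simp [mul_comm]
  have eB : ∫ x : EdgeSample G d, (if x.1 then (1 : ℝ) else 0) *
      (1 * (1 * (σ * Real.exp (2 * ∑ a, ∑ b, ‖x.2.2.2 a b‖)))) ∂edgeLaw G d k p q =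
      q * (σ * blockMoment d k) := by
    rw [edgeLaw, integral_prod_mul (fun b : Bool => if b then (1 : ℝ) else 0)
      (fun y : Bool × G × (Fin d → Fin d → ℂ) =>
        1 * (1 * (σ * Real.exp (2 * ∑ a, ∑ b, ‖y.2.2 a b‖)))),
      integral_prod_mul (fun _ : Bool => (1 : ℝ))
      (fun y : G × (Fin d → Fin d → ℂ) => 1 * (σ * Real.exp (2 * ∑ a, ∑ b, ‖y.2 a b‖))),
      integral_prod_mul (fun _ : G => (1 : ℝ))
      (fun g : Fin d → Fin d → ℂ => σ * Real.exp (2 * ∑ a, ∑ b, ‖g a b‖)), hb,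
      integral_const_mul]
    simp [blockMoment]
  have := integral_add (integrable_const (1 : ℝ)) (hA.add hB)
  simp only [Pi.add_apply] at this
  unfold expBound
  rw [this, integral_add hA hB, eA, eB]
  simp [mul_add]

/-- Chernoff's inequality at parameter `1` for the weight of one row. -/
theorem measureReal_le_rowWeight_le (k : GaussianKind) (p q : unitInterval) {σ : ℝ}
    (h0 : 0 ≤ σ) (h1 : σ ≤ 1) (i : Fin n) (t : ℝ) :
    (sampleLaw G d n k p q).real {s | t ≤ rowWeight σ s i} ≤
      Real.exp (n * (q * (4 * (1 - p) + σ * blockMoment d k)) - t) := by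
  have hK : 0 ≤ blockMoment d k := integral_nonneg fun _ => (Real.exp_pos _).le
  set η : ℝ := q * (4 * (1 - p) + σ * blockMoment d k) with hη
  have hη0 : 0 ≤ η := mul_nonneg q.2.1 (add_nonneg (mul_nonneg (by norm_num)
    (sub_nonneg.2 p.2.2)) (mul_nonneg h0 hK))
  obtain ⟨hbi, hbe⟩ := integrable_and_integral_expBound (G := G) (d := d) k p q σ
  have hei : Integrable (fun x => Real.exp (edgeWeight σ x)) (edgeLaw G d k p q) := by
    refine hbi.mono' (measurable_edgeWeight σ).exp.aestronglyMeasurable (ae_of_all _ fun x => ?_)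
    rw [Real.norm_of_nonneg (Real.exp_pos _).le]
    exact exp_edgeWeight_le h0 h1 x
  have hpres : ∀ e : Edge n, MeasurePreserving (fun s : Sample G d n => s e)
      (sampleLaw G d n k p q) (edgeLaw G d k p q) := fun e => measurePreserving_eval _ e
  let X : {j // j ≠ i} → Sample G d n → ℝ := fun j s => edgeWeight σ (s (edgeBetween i j.1 j.2))
  have hXm : ∀ j, Measurable (X j) := fun j =>
    (measurable_edgeWeight σ).comp (measurable_pi_apply _)
  have hind : iIndepFun X (sampleLaw G d n k p q) :=
    (iIndepFun_pi (μ := fun _ : Edge n => edgeLaw G d k p q)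
      (X := fun _ => edgeWeight σ) fun _ => (measurable_edgeWeight σ).aemeasurable).precomp
      (edgeBetween_injective i)
  have hXi : ∀ j, Integrable (fun s => Real.exp (1 * X j s)) (sampleLaw G d n k p q) := fun j => by
    simp only [one_mul]
    exact (hpres _).integrable_comp_of_integrable hei
  have hmgf : ∀ j, mgf (X j) (sampleLaw G d n k p q) 1 ≤ Real.exp η := fun j => by
    have : mgf (X j) (sampleLaw G d n k p q) 1 =
        ∫ x, Real.exp (edgeWeight σ x) ∂edgeLaw G d k p q := by
      rw [← (hpres (edgeBetween i j.1 j.2)).map_eq, integral_map (hpres _).aemeasurable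
        (measurable_edgeWeight σ).exp.aestronglyMeasurable]
      simp [mgf, X]
    rw [this]
    calc ∫ x, Real.exp (edgeWeight σ x) ∂edgeLaw G d k p q
        ≤ ∫ x, expBound σ x ∂edgeLaw G d k p q :=
          integral_mono hei hbi fun x => exp_edgeWeight_le h0 h1 x
      _ = η + 1 := by rw [hbe, add_comm]
      _ ≤ Real.exp η := Real.add_one_le_exp η
  have hrow : ∀ s, rowWeight σ s i = (∑ j, X j) s := fun s => by simp [rowWeight, X]
  simp_rw [hrow]
  refine (measure_ge_le_exp_mul_mgf t zero_le_one
    (hind.integrable_exp_mul_sum hXm fun j _ => hXi j)).trans ?_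
  rw [hind.mgf_sum hXm, sub_eq_neg_add, Real.exp_add, neg_one_mul]
  gcongr
  calc ∏ j, mgf (X j) (sampleLaw G d n k p q) 1
      ≤ ∏ _j : {j // j ≠ i}, Real.exp η := Finset.prod_le_prod (fun _ _ => mgf_nonneg)
        fun j _ => hmgf j
    _ = Real.exp (Fintype.card {j // j ≠ i} * η) := by
        rw [Finset.prod_const, ← Real.exp_nat_mul, Finset.card_univ]
    _ ≤ Real.exp (n * η) := by
        gcongr
        simp

theorem measureReal_exists_le_rowWeight_le (k : GaussianKind) (p q : unitInterval) {σ : ℝ}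
    (h0 : 0 ≤ σ) (h1 : σ ≤ 1) (t : ℝ) :
    (sampleLaw G d n k p q).real {s | ∃ i, t ≤ rowWeight σ s i} ≤
      n * Real.exp (n * (q * (4 * (1 - p) + σ * blockMoment d k)) - t) := by
  rw [Set.ofPred_exists]
  refine (measureReal_iUnion_fintype_le _).trans ?_
  refine (Finset.sum_le_sum fun i _ => measureReal_le_rowWeight_le k p q h0 h1 i t).trans ?_
  simp

end Tail

/-! ### Consequences of the asymptotic hypotheses -/

/-- In fact `(√(n p q) β)² = (1 - p + σ²) / p`. -/
theorem one_sub_add_sq_le_sq_sqrt_mul_beta {n : ℕ} {p q σ : ℝ} (hp1 : p ≤ 1)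
    (hq : 0 ≤ q) (hm : 0 < n * p * q) :
    1 - p + σ ^ 2 ≤ (√(n * p * q) * beta n p q σ) ^ 2 := by
  have hn : (0 : ℝ) ≤ n := n.cast_nonneg
  have hp : 0 < p := pos_of_mul_pos_right (pos_of_mul_pos_left hm hq) hn
  have hx : 0 ≤ 1 - p + σ ^ 2 := by nlinarith [sq_nonneg σ]
  have hq' : 0 < q := hq.lt_of_ne fun h => by simp [← h] at hm
  have hn' : (0 : ℝ) < n := hn.lt_of_ne fun h => by simp [← h] at hm
  have : (√(n * p * q) * beta n p q σ) ^ 2 = (1 - p + σ ^ 2) / p := by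
    rw [beta, tau, mul_pow, div_pow, mul_pow, Real.sq_sqrt hm.le, Real.sq_sqrt hn,
      Real.sq_sqrt (by positivity)]
    field_simp
  rw [this]
  exact le_div_self hx hp hp1

section Asymptotic

variable {p q : ℕ → unitInterval} {σ : ℕ → ℝ}

theorem eventually_mul_log_le {c : ℝ} (hc : 1 ≤ c)
    (hm : (fun n : ℕ => Real.log n ^ c) =o[atTop] (fun n : ℕ => (n : ℝ) * p n * q n))
    (C : ℝ) : ∀ᶠ n : ℕ in atTop, C * Real.log n ≤ n * p n * q n := by
  have hlog : ∀ᶠ n : ℕ in atTop, 1 ≤ Real.log n :=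
    (Real.tendsto_log_atTop.comp tendsto_natCast_atTop_atTop).eventually_ge_atTop 1
  have hC : 0 < (|C| + 1)⁻¹ := by positivity
  filter_upwards [hm.def hC, hlog] with n h hl
  have hm0 : (0 : ℝ) ≤ n * p n * q n :=
    mul_nonneg (mul_nonneg n.cast_nonneg (p n).2.1) (q n).2.1
  rw [Real.norm_of_nonneg (by positivity), Real.norm_of_nonneg hm0, inv_mul_eq_div,
    le_div_iff₀' (by positivity)] at h
  refine le_trans ?_ h
  gcongr
  · linarith [le_abs_self C]
  · exact Real.self_le_rpow_of_one_le hl hc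

theorem tendsto_one_sub_add_sq {c : ℝ} (hc : 1 ≤ c)
    (hm : (fun n : ℕ => Real.log n ^ c) =o[atTop] (fun n : ℕ => (n : ℝ) * p n * q n))
    (hβ : (fun n : ℕ => √((n : ℝ) * p n * q n) * beta n (p n) (q n) (σ n))
      =o[atTop] (fun _ : ℕ => (1 : ℝ))) :
    Tendsto (fun n => 1 - (p n : ℝ) + σ n ^ 2) atTop (𝓝 0) := by
  have h2 := ((isLittleO_one_iff ℝ).1 hβ).pow 2
  rw [zero_pow two_ne_zero] at h2
  refine tendsto_of_tendsto_of_tendsto_of_le_of_le' tendsto_const_nhds h2 ?_ ?_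
  · exact Eventually.of_forall fun n => add_nonneg (sub_nonneg.2 (p n).2.2) (sq_nonneg _)
  · filter_upwards [eventually_mul_log_le hc hm 1,
      (Real.tendsto_log_atTop.comp tendsto_natCast_atTop_atTop).eventually_ge_atTop 1] with n h hl
    refine one_sub_add_sq_le_sq_sqrt_mul_beta (p n).2.2 (q n).2.1 ?_
    rw [one_mul] at h
    exact (zero_lt_one.trans_le hl).trans_le h

/-- Under the asymptotic hypotheses, for each `ε > 0` the probability that some row weight exceeds
`ε n p q` is eventually at most `n⁻²`, hence summable. -/
theorem eventually_measureReal_exists_le_rowWeight_le {G : Type*} [Group G] [TopologicalSpace G]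
    [IsTopologicalGroup G] [CompactSpace G] [MeasurableSpace G] [BorelSpace G] {d : ℕ}
    (k : GaussianKind) (hσ : ∀ n, 0 ≤ σ n) {c : ℝ} (hc : 1 ≤ c)
    (hm : (fun n : ℕ => Real.log n ^ c) =o[atTop] (fun n : ℕ => (n : ℝ) * p n * q n))
    (hβ : (fun n : ℕ => √((n : ℝ) * p n * q n) * beta n (p n) (q n) (σ n))
      =o[atTop] (fun _ : ℕ => (1 : ℝ)))
    {ε : ℝ} (hε : 0 < ε) :
    ∀ᶠ n : ℕ in atTop, (sampleLaw G d n k (p n) (q n)).real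
      {s | ∃ i, ε * (n * p n * q n) ≤ rowWeight (σ n) s i} ≤ 1 / (n : ℝ) ^ 2 := by
  have h0 := tendsto_one_sub_add_sq hc hm hβ
  have hσ0 : Tendsto (fun n => σ n ^ 2) atTop (𝓝 0) :=
    squeeze_zero (fun _ => sq_nonneg _)
      (fun n => le_add_of_nonneg_left (sub_nonneg.2 (p n).2.2)) h0
  have hσ1 : Tendsto σ atTop (𝓝 0) := by
    have := hσ0.sqrt
    simpa [Real.sqrt_sq (hσ _)] using this
  have hp1 : Tendsto (fun n => 1 - (p n : ℝ)) atTop (𝓝 0) :=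
    squeeze_zero (fun n => sub_nonneg.2 (p n).2.2)
      (fun n => le_add_of_nonneg_right (sq_nonneg _)) h0
  have hη : Tendsto (fun n => 4 * (1 - (p n : ℝ)) + σ n * blockMoment d k) atTop (𝓝 0) := by
    simpa using (hp1.const_mul 4).add (hσ1.mul_const (blockMoment d k))
  filter_upwards [hσ1.eventually_le_const zero_lt_one,
    hp1.eventually_le_const (show (0 : ℝ) < 1 / 2 by norm_num),
    hη.eventually_le_const (show 0 < ε / 4 by positivity),
    eventually_mul_log_le hc hm (6 / ε), eventually_gt_atTop 0] with n hs hp he hl hn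
  refine (measureReal_exists_le_rowWeight_le k (p n) (q n) (hσ n) hs _).trans ?_
  have hn' : (0 : ℝ) < n := by exact_mod_cast hn
  have hq0 : (0 : ℝ) ≤ n * q n := mul_nonneg hn'.le (q n).2.1
  have h1 : (n : ℝ) * (q n * (4 * (1 - p n) + σ n * blockMoment d k)) ≤
      ε / 2 * (n * p n * q n) := by
    calc (n : ℝ) * (q n * (4 * (1 - p n) + σ n * blockMoment d k))
        ≤ n * q n * (ε / 4) := by rw [← mul_assoc]; gcongr
      _ ≤ n * q n * (ε / 2 * p n) := by gcongr; nlinarith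
      _ = ε / 2 * (n * p n * q n) := by ring
  -- one factor `n` of `n⁻³` is spent on the union bound over the rows
  have h2 : 3 * Real.log n ≤ ε / 2 * (n * p n * q n) := by
    calc 3 * Real.log n = ε / 2 * (6 / ε * Real.log n) := by field_simp; ring
      _ ≤ _ := by gcongr
  calc (n : ℝ) * Real.exp _ ≤ n * Real.exp (-(3 * Real.log n)) := by gcongr; linarith
    _ = 1 / (n : ℝ) ^ 2 := by
      rw [Real.exp_neg, ← Nat.cast_ofNat, Real.exp_nat_mul, Real.exp_log hn']
      field_simp

end Asymptotic

end GroupSync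

theorem mainTheorem6 :
    ∃ c₀ : ℝ, 1 < c₀ ∧ ∀ c : ℝ, c₀ ≤ c →
      ∀ (G : Type*) [Group G] [TopologicalSpace G] [IsTopologicalGroup G] [CompactSpace G]
        [T2Space G] [MeasurableSpace G] [BorelSpace G]
        (d : ℕ) (π : G →* Matrix.unitaryGroup (Fin d) ℂ),
        Continuous π → π ≠ 1 → (GroupSync.toRepresentation π).IsIrreducible →
      ∀ (k : GroupSync.GaussianKind) (p q : ℕ → unitInterval) (σ : ℕ → ℝ),
        (∀ n, 0 ≤ σ n) →
        (fun n : ℕ => Real.log n ^ c) =o[atTop] (fun n : ℕ => (n : ℝ) * p n * q n) →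
        (fun n : ℕ => √((n : ℝ) * p n * q n) * GroupSync.beta n (p n) (q n) (σ n))
          =o[atTop] (fun _ : ℕ => (1 : ℝ)) →
      ∀ (Ω : Type*) [MeasurableSpace Ω] (P : Measure Ω) [IsProbabilityMeasure P]
        (S : (n : ℕ) → Ω → GroupSync.Sample G d n),
        (∀ n, HasLaw (S n) (GroupSync.sampleLaw G d n k (p n) (q n)) P) →
        ∀ᵐ ω ∂P, Tendsto
          (fun n : ℕ => GroupSync.opNorm
            ((GroupSync.beta n (p n) (q n) (σ n) : ℂ) •
              GroupSync.noiseMatrix π (p n) (q n) (σ n) (S n ω)))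
          atTop (𝓝 0) := by
  refine ⟨2, one_lt_two, fun c hc G _ _ _ _ _ _ _ d π _ _ _ k p q σ hσ hm hβ Ω _ P _ S hS => ?_⟩
  have hc1 : 1 ≤ c := by linarith
  have hm0 : ∀ n : ℕ, (0 : ℝ) ≤ n * p n * q n := fun n =>
    mul_nonneg (mul_nonneg n.cast_nonneg (p n).2.1) (q n).2.1
  -- Borel–Cantelli, for each fixed `ε` of the form `1 / (N + 1)`
  have hBC : ∀ N : ℕ, ∀ᵐ ω ∂P, ∀ᶠ n : ℕ in atTop, ∀ i,
      GroupSync.rowWeight (σ n) (S n ω) i < 1 / ((N : ℝ) + 1) * (n * p n * q n) := by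
    intro N
    have hev := GroupSync.eventually_measureReal_exists_le_rowWeight_le (G := G) (d := d) k hσ hc1
      hm hβ (Nat.one_div_pos_of_nat (n := N) (α := ℝ))
    have hmeas : ∀ n : ℕ, MeasurableSet {s : GroupSync.Sample G d n |
        ∃ i, 1 / ((N : ℝ) + 1) * (n * p n * q n) ≤ GroupSync.rowWeight (σ n) s i} := fun n => by
      rw [Set.ofPred_exists]
      exact MeasurableSet.iUnion fun i =>
        measurableSet_le measurable_const (GroupSync.measurable_rowWeight _ i)
    have hsum := Summable.of_norm_bounded_eventually_nat
      (Real.summable_one_div_nat_pow.2 one_lt_two)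
      (hev.mono fun n h => (Real.norm_of_nonneg measureReal_nonneg).trans_le h)
    have hfin : ∑' n : ℕ, P {ω | ∃ i, 1 / ((N : ℝ) + 1) * (n * p n * q n) ≤
        GroupSync.rowWeight (σ n) (S n ω) i} ≠ ⊤ := by
      refine ne_of_eq_of_ne (tsum_congr fun n => ?_) hsum.tsum_ofReal_ne_top
      rw [ofReal_measureReal]
      exact (hS n).measure_eq (hmeas n)
    filter_upwards [ae_eventually_notMem hfin] with ω hω
    filter_upwards [hω] with n hn
    simpa using hn
  filter_upwards [ae_all_iff.2 hBC] with ω hω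
  rw [tendsto_order]
  refine ⟨fun a ha => Eventually.of_forall fun n => ha.trans_le (norm_nonneg _), fun a ha => ?_⟩
  obtain ⟨N, hN⟩ := exists_nat_one_div_lt (show 0 < a / (d + 1) by positivity)
  filter_upwards [hω N] with n hn
  have hN0 : (0 : ℝ) ≤ 1 / ((N : ℝ) + 1) := by positivity
  refine (GroupSync.opNorm_beta_smul_noiseMatrix_le π (p n).2.1 (q n).2.1 (hσ n)
    (mul_nonneg hN0 (hm0 n)) (S n ω) fun i => (hn i).le).trans_lt ?_
  calc ((n : ℝ) * p n * q n)⁻¹ * (d * (1 / ((N : ℝ) + 1) * (n * p n * q n)))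
      = d * (1 / ((N : ℝ) + 1)) * ((n * p n * q n) * ((n : ℝ) * p n * q n)⁻¹) := by ring
    _ ≤ d * (1 / ((N : ℝ) + 1)) * 1 := by
        gcongr
        exact mul_inv_le_one
    _ ≤ (d + 1) * (1 / ((N : ℝ) + 1)) := by nlinarith
    _ < a := by rwa [lt_div_iff₀' (by positivity)] at hN
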